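/- A straight-line graph in the plane is a finite simple graph $N$ whose vertices are distinct points of $\mathbb{R}^2$ and whose edges are drawn as the line segments between their endpoints (edges may cross or overlap). A path of $N$ is drawn as the polygonal curve formed by its successive edges. A curve $f:[0,1]\to\mathbb{R}^2$ is \emph{self-approaching} if $|f(b)-f(c)|\le|f(a)-f(c)|$ for all $0\le a\le b\le c\le 1$, and it \emph{has increasing chords} if $|f(b)-f(c)|\le|f(a)-f(d)|$ for all $0\le a\le b\le c\le d\le 1$, where $|\cdot|$ is the Euclidean norm. A straight-line graph $N$ is an \emph{increasing-chord} (respectively \emph{self-approaching}) \emph{Steiner network} for a finite set $P\subset\mathbb{R}^2$ if every point of $P$ is a vertex of $N$ and, for every ordered pair $p,q\in P$, some path of $N$ from $p$ to $q$ is drawn as a curve that has increasing chords (respectively is self-approaching). **Theorem.** There is an absolute constant $C$ such that for every $n\ge 0$ and every set $P$ of $n$ points in the plane there is a straight-line graph $N$ with at most $Cn$ vertices and at most $Cn$ edges that is an increasing-chord Steiner network for $P$; in particular, $N$ is also a self-approaching Steiner network for $P$. -/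

import Mathlib

open scoped unitInterval

/-- The plane `ℝ²` with the Euclidean metric. -/
abbrev Plane : Type := EuclideanSpace ℝ (Fin 2)

/-- A curve `f : [0,1] → ℝ²` is self-approaching if for any three points `a, b, c` in order along
the curve, `D(a,c) ≥ D(b,c)`. -/
def IsSelfApproaching {s t : Plane} (f : Path s t) : Prop :=
  ∀ a b c : I, a ≤ b → b ≤ c → dist (f b) (f c) ≤ dist (f a) (f c)

/-- A curve `f : [0,1] → ℝ²` has increasing chords if for any four points `a, b, c, d` in order
along the curve, `D(a,d) ≥ D(b,c)`. -/
def HasIncreasingChords {s t : Plane} (f : Path s t) : Prop :=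
  ∀ a b c d : I, a ≤ b → b ≤ c → c ≤ d → dist (f b) (f c) ≤ dist (f a) (f d)

/-- A finite simple graph drawn in the plane with straight edges: the vertices are distinct points
of the plane, and each edge is drawn as the line segment joining its two endpoints.
Edges may cross or overlap. -/
structure StraightLineGraph where
  /-- The vertices. -/
  verts : Finset Plane
  /-- The adjacency relation between the vertices. -/
  graph : SimpleGraph {x : Plane // x ∈ verts}

namespace StraightLineGraph

variable (N : StraightLineGraph)

/-- The number of vertices. -/
def numVerts : ℕ := N.verts.card

/-- The number of edges. -/
noncomputable def numEdges : ℕ := N.graph.edgeSet.ncard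

variable {N}

/-- The polygonal curve that a walk of the graph traces in the drawing: the segments of its
successive edges, concatenated in order. -/
noncomputable def walkCurve : {u v : {x : Plane // x ∈ N.verts}} → N.graph.Walk u v →
    Path (u : Plane) (v : Plane)
  | u, _, .nil => Path.refl (u : Plane)
  | u, _, .cons (v := w) _ p => (Path.segment (u : Plane) (w : Plane)).trans (walkCurve p)

variable (N)

/-- `N` is a self-approaching Steiner network for `P`: the points of `P` are vertices of `N`, and
for each ordered pair `p, q` of points of `P` some path of the graph from `p` to `q` is drawn as a
self-approaching curve. -/
def IsSelfApproachingSteinerNetwork (P : Finset Plane) : Prop :=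
  ∃ hP : P ⊆ N.verts, ∀ (p q : Plane) (hp : p ∈ P) (hq : q ∈ P),
    ∃ w : N.graph.Walk ⟨p, hP hp⟩ ⟨q, hP hq⟩, w.IsPath ∧ IsSelfApproaching (walkCurve w)

/-- `N` is an increasing-chord Steiner network for `P`: the points of `P` are vertices of `N`, and
for each pair `p, q` of points of `P` some path of the graph from `p` to `q` is drawn as a curve
with increasing chords. -/
def IsIncreasingChordSteinerNetwork (P : Finset Plane) : Prop :=
  ∃ hP : P ⊆ N.verts, ∀ (p q : Plane) (hp : p ∈ P) (hq : q ∈ P),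
    ∃ w : N.graph.Walk ⟨p, hP hp⟩ ⟨q, hP hq⟩, w.IsPath ∧ HasIncreasingChords (walkCurve w)

end StraightLineGraph

/-! Two vectors of a cone of half-angle 45° have nonnegative inner product, so a polygonal curve
whose edges all lie in one such cone has increasing chords. It is enough to join each pair of points
by a walk whose steps lie in a common cone, using linearly many pairs in total.

Nested nets of `P` at scales `2 ^ i * δ` give every point an ancestor at each level. For each of
finitely many directions `u`, net points are lifted to gates along `u`, at a height growing like the
scale. The height gained per level dominates the sideways move to the parent, so climbing the tree
stays in the cone of `u` (`coneStep_par`). To get from `p` to `q`, climb the `u`-tree to the level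
where the ancestors' distance is comparable to the scale (`exists_level`), cross to a gate of the
`-u`-tree (`coneStep_cross`) and descend it; reversed steps of that tree lie in the cone of `u`.

Linear size has two sources. Packing, together with the bounded number of levels at which one of two
close net points survives, bounds the close pairs (`exists_card_close_le`). A net point may survive
through many levels, so only marked gates are kept, and each is joined directly to the next marked
one above it. -/

/-! ### Cones and increasing chords -/

/-- The closed cone of half-angle `45°` around the direction `u`. -/
def InCone (u v : Plane) : Prop := ‖v - inner ℝ u v • u‖ ≤ inner ℝ u v

namespace InCone

variable {u v w : Plane}

theorem zero (u : Plane) : InCone u 0 := by simp [InCone]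

theorem add (hv : InCone u v) (hw : InCone u w) : InCone u (v + w) := by
  unfold InCone at *
  have h : v + w - inner ℝ u (v + w) • u
      = (v - inner ℝ u v • u) + (w - inner ℝ u w • u) := by
    rw [inner_add_right, add_smul]; abel
  rw [h, inner_add_right]
  exact (norm_add_le _ _).trans (add_le_add hv hw)

theorem smul {t : ℝ} (ht : 0 ≤ t) (hv : InCone u v) : InCone u (t • v) := by
  unfold InCone at *
  rw [inner_smul_right, mul_smul, ← smul_sub, norm_smul, Real.norm_of_nonneg ht]
  exact mul_le_mul_of_nonneg_left hv ht

theorem neg_left : InCone (-u) v ↔ InCone u (-v) := by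
  unfold InCone
  rw [inner_neg_left, inner_neg_right, neg_smul_neg, ← norm_neg, neg_smul]
  congr! 2
  abel

/-- By Cauchy–Schwarz, the parts orthogonal to `u` contribute at least minus the product of their
norms, which the product of the axial parts outweighs. -/
theorem inner_nonneg (hu : ‖u‖ = 1) (hv : InCone u v) (hw : InCone u w) :
    0 ≤ inner ℝ v w := by
  unfold InCone at *
  have h := abs_real_inner_le_norm (v - inner ℝ u v • u) (w - inner ℝ u w • u)
  have huu : inner ℝ u u = (1 : ℝ) := by rw [real_inner_self_eq_norm_sq, hu]; norm_num
  have e : inner ℝ (v - inner ℝ u v • u) (w - inner ℝ u w • u)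
      = inner ℝ v w - inner ℝ u v * inner ℝ u w := by
    simp only [inner_sub_left, inner_sub_right, inner_smul_left, inner_smul_right, huu,
      real_inner_comm u v, RCLike.conj_to_real]
    ring
  have h2 : ‖v - inner ℝ u v • u‖ * ‖w - inner ℝ u w • u‖ ≤ inner ℝ u v * inner ℝ u w :=
    mul_le_mul hv hw (norm_nonneg _) ((norm_nonneg _).trans hv)
  rw [e] at h
  linarith [neg_abs_le (inner ℝ v w - inner ℝ u v * inner ℝ u w)]

/-- The error `v - t • u` costs at most `t / 2` of axial length and creates at most `t / 2` of
orthogonal length. This is the test applied to slanted edges. -/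
theorem of_norm_sub_le (hu : ‖u‖ = 1) {t : ℝ} (h : ‖v - t • u‖ ≤ t / 2) : InCone u v := by
  have huu : inner ℝ u u = (1 : ℝ) := by rw [real_inner_self_eq_norm_sq, hu]; norm_num
  have h1 : |inner ℝ u v - t| ≤ ‖v - t • u‖ := by
    have := abs_real_inner_le_norm u (v - t • u)
    rwa [inner_sub_right, inner_smul_right, huu, hu, mul_one, one_mul] at this
  have h2 : ‖v - inner ℝ u v • u‖ ≤ ‖v - t • u‖ := by
    refine le_of_sq_le_sq ?_ (norm_nonneg _)
    have e : v - t • u = (v - inner ℝ u v • u) + (inner ℝ u v - t) • u := by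
      rw [sub_smul]; abel
    have o : inner ℝ (v - inner ℝ u v • u) ((inner ℝ u v - t) • u) = (0 : ℝ) := by
      rw [inner_smul_right, inner_sub_left, inner_smul_left, huu, real_inner_comm]
      simp
    rw [e, norm_add_sq_real, o]
    nlinarith [sq_nonneg ‖(inner ℝ u v - t) • u‖]
  unfold InCone
  linarith [(abs_le.1 h1).1]

theorem smul_self (hu : ‖u‖ = 1) {t : ℝ} (ht : 0 ≤ t) : InCone u (t • u) :=
  of_norm_sub_le hu (t := t) (by rw [sub_self, norm_zero]; positivity)

/-- A chord of a concatenation of three vectors of a cone is at least as long as the middle one. -/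
theorem norm_le_norm_add_add {x y z : Plane} (hu : ‖u‖ = 1) (hx : InCone u x) (hy : InCone u y)
    (hz : InCone u z) : ‖y‖ ≤ ‖x + y + z‖ := by
  refine le_of_sq_le_sq ?_ (norm_nonneg _)
  have e : x + y + z = y + (x + z) := by abel
  rw [e, norm_add_sq_real]
  nlinarith [inner_nonneg hu hy (hx.add hz), sq_nonneg ‖x + z‖]

end InCone

/-- All the chords of the curve `f` point into the cone around `u`. -/
def ConeMonotone (u : Plane) {s t : Plane} (f : Path s t) : Prop :=
  ∀ a b : I, a ≤ b → InCone u (f b - f a)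

namespace ConeMonotone

variable {u x y z : Plane}

theorem refl (u x : Plane) : ConeMonotone u (Path.refl x) := fun a b _ => by
  simpa using InCone.zero u

theorem segment (h : InCone u (y - x)) : ConeMonotone u (Path.segment x y) := fun a b hab => by
  have e : Path.segment x y b - Path.segment x y a = ((b : ℝ) - a) • (y - x) := by
    simp only [Path.segment_apply, AffineMap.lineMap_apply_module']
    module
  rw [e]
  exact h.smul (sub_nonneg.2 hab)

theorem trans {f : Path x y} {g : Path y z} (hf : ConeMonotone u f) (hg : ConeMonotone u g) :
    ConeMonotone u (f.trans g) := fun a b hab => by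
  have hab' : (a : ℝ) ≤ b := hab
  rw [Path.trans_apply, Path.trans_apply]
  split_ifs with hb ha ha
  · exact hf _ _ (Subtype.mk_le_mk.2 (by linarith))
  · linarith
  · have h1 := hf ⟨2 * a, (unitInterval.mul_pos_mem_iff zero_lt_two).2 ⟨a.2.1, ha⟩⟩ 1
      unitInterval.le_one'
    have h2 := hg 0 ⟨2 * b - 1, unitInterval.two_mul_sub_one_mem_iff.2
      ⟨(not_le.1 hb).le, b.2.2⟩⟩ unitInterval.nonneg'
    rw [f.target] at h1
    rw [g.source] at h2
    simpa using h2.add h1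
  · exact hg _ _ (Subtype.mk_le_mk.2 (by linarith))

theorem hasIncreasingChords {f : Path x y} (hu : ‖u‖ = 1) (hf : ConeMonotone u f) :
    HasIncreasingChords f := fun a b c d hab hbc hcd => by
  rw [dist_comm (f b), dist_comm (f a), dist_eq_norm, dist_eq_norm]
  have e : f d - f a = (f b - f a) + (f c - f b) + (f d - f c) := by abel
  rw [e]
  exact InCone.norm_le_norm_add_add hu (hf _ _ hab) (hf _ _ hbc) (hf _ _ hcd)

theorem walkCurve {N : StraightLineGraph} : ∀ {p q : {x : Plane // x ∈ N.verts}}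
    (w : N.graph.Walk p q), (∀ d ∈ w.darts, InCone u ((d.snd : Plane) - d.fst)) →
    ConeMonotone u (StraightLineGraph.walkCurve w)
  | _, _, .nil, _ => ConeMonotone.refl _ _
  | _, _, .cons h w, hw => by
    rw [SimpleGraph.Walk.darts_cons] at hw
    exact (ConeMonotone.segment (hw _ List.mem_cons_self)).trans
      (ConeMonotone.walkCurve w fun d hd => hw d (List.mem_cons_of_mem _ hd))

end ConeMonotone

theorem HasIncreasingChords.isSelfApproaching {x y : Plane} {f : Path x y}
    (h : HasIncreasingChords f) : IsSelfApproaching f :=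
  fun a b c hab hbc => h a b c c hab hbc le_rfl

/-! ### Graphs spanned by pairs of points -/

namespace StraightLineGraph

open Classical in
/-- The straight-line graph with vertex set `P` and the endpoints of `E`, whose edges are the
nondegenerate pairs of `E`. -/
noncomputable def ofPairs (P : Finset Plane) (E : Finset (Plane × Plane)) : StraightLineGraph where
  verts := P ∪ (E.image Prod.fst ∪ E.image Prod.snd)
  graph := SimpleGraph.fromRel fun x y => ((x : Plane), (y : Plane)) ∈ E

variable {P : Finset Plane} {E : Finset (Plane × Plane)}

theorem numVerts_ofPairs_le : (ofPairs P E).numVerts ≤ P.card + 2 * E.card := by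
  classical
  have h1 := Finset.card_union_le P (E.image Prod.fst ∪ E.image Prod.snd)
  have h2 := Finset.card_union_le (E.image Prod.fst) (E.image Prod.snd)
  have h3 : (E.image Prod.fst).card ≤ E.card := Finset.card_image_le
  have h4 : (E.image Prod.snd).card ≤ E.card := Finset.card_image_le
  have e : (ofPairs P E).numVerts = (P ∪ (E.image Prod.fst ∪ E.image Prod.snd)).card := by
    unfold numVerts ofPairs; congr!
  omega

theorem numEdges_ofPairs_le : (ofPairs P E).numEdges ≤ E.card := by
  classical
  have hinj : Function.Injective (Sym2.map (Subtype.val : {x // x ∈ (ofPairs P E).verts} → Plane)) :=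
    Sym2.map.injective Subtype.val_injective
  unfold numEdges
  rw [← Set.ncard_image_of_injective _ hinj]
  refine (Set.ncard_le_ncard (t := ↑(E.image fun e => s(e.1, e.2))) ?_
    (Finset.finite_toSet _)).trans ?_
  · rintro _ ⟨e, he, rfl⟩
    induction e with
    | _ x y =>
      rw [SimpleGraph.mem_edgeSet] at he
      obtain ⟨-, h | h⟩ := he
      · exact Finset.mem_coe.2 (Finset.mem_image.2 ⟨_, h, rfl⟩)
      · exact Finset.mem_coe.2 (Finset.mem_image.2 ⟨_, h, Sym2.eq_swap⟩)
  · rw [Set.ncard_coe_finset]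
    exact Finset.card_image_le

end StraightLineGraph

/-- One step along a pair of `E`, in either direction, whose displacement lies in the cone
around `u`. -/
def ConeStep (E : Finset (Plane × Plane)) (u x y : Plane) : Prop :=
  ((x, y) ∈ E ∨ (y, x) ∈ E) ∧ InCone u (y - x)

namespace StraightLineGraph

variable {P : Finset Plane} {E : Finset (Plane × Plane)}

theorem exists_walk_of_reflTransGen {u p q : Plane} (h : Relation.ReflTransGen (ConeStep E u) p q)
    (hq : q ∈ (ofPairs P E).verts) (hp : p ∈ (ofPairs P E).verts) :
    ∃ w : (ofPairs P E).graph.Walk ⟨p, hp⟩ ⟨q, hq⟩,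
      ∀ d ∈ w.darts, InCone u ((d.snd : Plane) - d.fst) := by
  classical
  induction h using Relation.ReflTransGen.head_induction_on with
  | refl => exact ⟨.nil, by simp⟩
  | @head a b hab _ ih =>
    have hb : b ∈ (ofPairs P E).verts := by
      refine Finset.mem_union_right _ (Finset.mem_union.2 ?_)
      rcases hab.1 with h | h
      · exact .inr (Finset.mem_image.2 ⟨_, h, rfl⟩)
      · exact .inl (Finset.mem_image.2 ⟨_, h, rfl⟩)
    obtain ⟨w, hw⟩ := ih hb
    by_cases hne : a = b
    · subst hne; exact ⟨w, hw⟩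
    · have hadj : (ofPairs P E).graph.Adj ⟨a, hp⟩ ⟨b, hb⟩ :=
        (SimpleGraph.fromRel_adj _ _ _).2 ⟨fun h => hne (congrArg Subtype.val h), hab.1⟩
      refine ⟨.cons hadj w, fun d hd => ?_⟩
      rw [SimpleGraph.Walk.darts_cons] at hd
      rcases List.mem_cons.1 hd with rfl | hd
      · exact hab.2
      · exact hw d hd

theorem exists_path_hasIncreasingChords {u p q : Plane} (hu : ‖u‖ = 1)
    (h : Relation.ReflTransGen (ConeStep E u) p q)
    (hp : p ∈ (ofPairs P E).verts) (hq : q ∈ (ofPairs P E).verts) :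
    ∃ w : (ofPairs P E).graph.Walk ⟨p, hp⟩ ⟨q, hq⟩,
      w.IsPath ∧ HasIncreasingChords (walkCurve w) := by
  classical
  obtain ⟨w, hw⟩ := exists_walk_of_reflTransGen h hq hp
  -- Removing cycles keeps only darts of `w`, so the cone condition survives.
  exact ⟨w.bypass, w.bypass_isPath, (ConeMonotone.walkCurve w.bypass fun d hd =>
    hw d (w.darts_bypass_subset_darts hd)).hasIncreasingChords hu⟩

end StraightLineGraph

/-! ### Hierarchical nets -/

theorem exists_net_retraction (S : Finset Plane) {r : ℝ} (hr : 0 ≤ r) :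
    ∃ T ⊆ S, (∀ a ∈ T, ∀ b ∈ T, a ≠ b → r ≤ dist a b) ∧
      ∃ f : Plane → Plane, (∀ a ∈ S, f a ∈ T ∧ dist a (f a) ≤ r) ∧ ∀ a ∈ T, f a = a := by
  classical
  suffices h : ∃ T ⊆ S, (∀ a ∈ T, ∀ b ∈ T, a ≠ b → r ≤ dist a b) ∧
      ∀ a ∈ S, ∃ b ∈ T, dist a b ≤ r by
    obtain ⟨T, hT, hsep, hcov⟩ := h
    choose! f hf using hcov
    refine ⟨T, hT, hsep, fun a => if a ∈ T then a else f a, fun a ha => ?_, fun a ha => if_pos ha⟩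
    by_cases haT : a ∈ T
    · simp [haT, hr]
    · simpa [haT] using hf a ha
  induction S using Finset.induction_on with
  | empty => exact ⟨∅, by simp⟩
  | insert x S _ ih =>
    obtain ⟨T, hT, hsep, hcov⟩ := ih
    by_cases hx : ∃ b ∈ T, dist x b ≤ r
    · refine ⟨T, hT.trans (Finset.subset_insert _ _), hsep, fun a ha => ?_⟩
      rcases Finset.mem_insert.1 ha with rfl | ha
      · exact hx
      · exact hcov a ha
    · push Not at hx
      refine ⟨insert x T, Finset.insert_subset_insert _ hT, fun a ha b hb hab => ?_,
        fun a ha => ?_⟩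
      · rcases Finset.mem_insert.1 ha with rfl | ha' <;> rcases Finset.mem_insert.1 hb with rfl | hb'
        · exact absurd rfl hab
        · exact (hx b hb').le
        · rw [dist_comm]; exact (hx a ha').le
        · exact hsep a ha' b hb' hab
      · rcases Finset.mem_insert.1 ha with rfl | ha
        · exact ⟨a, Finset.mem_insert_self _ _, by simpa using hr⟩
        · obtain ⟨b, hb, h⟩ := hcov a ha
          exact ⟨b, Finset.mem_insert_of_mem hb, h⟩

theorem exists_pos_separation (P : Finset Plane) :
    ∃ δ : ℝ, 0 < δ ∧ ∀ a ∈ P, ∀ b ∈ P, a ≠ b → δ ≤ dist a b := by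
  classical
  induction P using Finset.induction_on with
  | empty => exact ⟨1, one_pos, by simp⟩
  | insert x P hx ih =>
    obtain ⟨δ, hδ, h⟩ := ih
    obtain ⟨ε, hε, h'⟩ : ∃ ε : ℝ, 0 < ε ∧ ∀ b ∈ P, ε ≤ dist x b := by
      have hne := (Set.toFinite (P : Set Plane)).isClosed.isOpen_compl.mem_nhds
        (x := x) (by simpa using hx)
      obtain ⟨ε, hε, hb⟩ := Metric.mem_nhds_iff.1 hne
      refine ⟨ε, hε, fun b hbP => ?_⟩
      by_contra! hlt
      exact hb (show b ∈ Metric.ball x ε by rwa [Metric.mem_ball, dist_comm]) hbP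
    refine ⟨min δ ε, lt_min hδ hε, fun a ha b hb hab => ?_⟩
    rcases Finset.mem_insert.1 ha with rfl | ha' <;> rcases Finset.mem_insert.1 hb with rfl | hb'
    · exact absurd rfl hab
    · exact (min_le_right _ _).trans (h' b hb')
    · rw [dist_comm]; exact (min_le_right _ _).trans (h' a ha')
    · exact (min_le_left _ _).trans (h a ha' b hb' hab)

/-- A nested sequence of nets of `P` at the scales `2 ^ i * δ`, with retractions of each net onto
the next coarser one. -/
structure NetHierarchy (P : Finset Plane) where
  /-- The finest scale. -/
  δ : ℝ
  δ_pos : 0 < δ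
  /-- The nets. -/
  net : ℕ → Finset Plane
  /-- The retractions. -/
  par : ℕ → Plane → Plane
  net_zero : net 0 = P
  net_succ_subset : ∀ i, net (i + 1) ⊆ net i
  separated : ∀ i, ∀ a ∈ net i, ∀ b ∈ net i, a ≠ b → 2 ^ i * δ ≤ dist a b
  par_mem : ∀ i, ∀ a ∈ net i, par i a ∈ net (i + 1)
  par_eq : ∀ i, ∀ a ∈ net (i + 1), par i a = a
  dist_par : ∀ i, ∀ a ∈ net i, dist a (par i a) ≤ 2 ^ (i + 1) * δ

theorem NetHierarchy.nonempty (P : Finset Plane) : Nonempty (NetHierarchy P) := by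
  obtain ⟨δ, hδ, hP⟩ := exists_pos_separation P
  have key (i : ℕ) (S : Finset Plane) := exists_net_retraction S (r := 2 ^ (i + 1) * δ)
    (by positivity)
  choose T hT hsep f hf hfT using key
  obtain ⟨net, h0, hs⟩ : ∃ net : ℕ → Finset Plane, net 0 = P ∧ ∀ i, net (i + 1) = T i (net i) :=
    ⟨fun n => Nat.rec P T n, rfl, fun _ => rfl⟩
  exact ⟨{
    δ := δ
    δ_pos := hδ
    net := net
    par := fun i => f i (net i)
    net_zero := h0
    net_succ_subset := fun i => hs i ▸ hT i _
    separated := by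
      rintro (_ | i)
      · simpa [h0] using hP
      · rw [hs]; exact hsep i _
    par_mem := fun i a ha => hs i ▸ (hf i _ a ha).1
    par_eq := fun i a ha => hfT i _ a (hs i ▸ ha)
    dist_par := fun i a ha => (hf i _ a ha).2 }⟩

namespace NetHierarchy

variable {P : Finset Plane} (H : NetHierarchy P)

theorem net_antitone : Antitone H.net := antitone_nat_of_succ_le H.net_succ_subset

theorem net_subset (i : ℕ) : H.net i ⊆ P :=
  (H.net_antitone (Nat.zero_le i)).trans_eq H.net_zero

theorem scale_pos (i : ℕ) : 0 < 2 ^ i * H.δ := mul_pos (by positivity) H.δ_pos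

theorem exists_height : ∃ L : ℕ, ∀ i, ∀ a ∈ H.net i, ∀ b ∈ H.net i, a ≠ b → i < L := by
  obtain ⟨L, hL⟩ := pow_unbounded_of_one_lt (Metric.diam (P : Set Plane) / H.δ) one_lt_two
  rw [div_lt_iff₀ H.δ_pos] at hL
  refine ⟨L, fun i a ha b hb hab => ?_⟩
  by_contra! hi
  have h1 := H.separated L a (H.net_antitone hi ha) b (H.net_antitone hi hb) hab
  have h2 := Metric.dist_le_diam_of_mem (Set.toFinite (P : Set Plane)).isBounded
    (Finset.mem_coe.2 (H.net_subset i ha)) (Finset.mem_coe.2 (H.net_subset i hb))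
  linarith

/-- A number `L` such that the nets from the `L`-th on have at most one point. -/
noncomputable def height : ℕ := H.exists_height.choose

theorem lt_height {i : ℕ} {a b : Plane} (ha : a ∈ H.net i) (hb : b ∈ H.net i) (hab : a ≠ b) :
    i < H.height := H.exists_height.choose_spec i a ha b hb hab

/-- The net point representing `p` at level `i`. -/
def anc (p : Plane) : ℕ → Plane
  | 0 => p
  | i + 1 => H.par i (anc p i)

theorem anc_mem {p : Plane} (hp : p ∈ P) : ∀ i, H.anc p i ∈ H.net i
  | 0 => by rw [H.net_zero]; exact hp
  | i + 1 => H.par_mem i _ (anc_mem hp i)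

/-- Sum of the geometric series of the jumps `2 ^ (k + 1) * δ` for `k < i`. -/
theorem dist_anc_le {p : Plane} (hp : p ∈ P) (i : ℕ) :
    dist p (H.anc p i) ≤ 2 * (2 ^ i - 1) * H.δ := by
  induction i with
  | zero => simp [anc]
  | succ i ih =>
    have h := H.dist_par i _ (H.anc_mem hp i)
    have := dist_triangle p (H.anc p i) (H.anc p (i + 1))
    rw [anc] at *
    rw [pow_succ] at *
    linarith

/-! ### Linear counting of dropped points and close pairs -/

open Classical in
/-- The pairs `(i, a)` such that `a` belongs to the net of level `i` but not to that of level
`i + k`. -/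
noncomputable def dropped (k : ℕ) : Finset (ℕ × Plane) :=
  (Finset.range H.height ×ˢ P).filter fun x => x.2 ∈ H.net x.1 ∧ x.2 ∉ H.net (x.1 + k)

/-- The nets are nested, so for each point the levels counted lie within a window of `k` consecutive
levels starting at the lowest one. -/
theorem card_dropped_le (k : ℕ) : (H.dropped k).card ≤ k * P.card := by
  classical
  refine Finset.card_le_mul_card_image_of_maps_to (s := H.dropped k) (f := Prod.snd)
    (fun x hx => (Finset.mem_product.1 (Finset.mem_filter.1 hx).1).2) k fun a _ => ?_
  rcases ((H.dropped k).filter fun x => x.2 = a).eq_empty_or_nonempty with h | h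
  · rw [h]; exact Nat.zero_le k
  obtain ⟨m, hm, hmin⟩ := Finset.exists_min_image _ Prod.fst h
  have hk : (Finset.Ico m.1 (m.1 + k)).card = k := by simp
  refine (Finset.card_le_card_of_injOn Prod.fst (fun x hx => ?_) ?_).trans hk.le
  · have hx' := Finset.mem_coe.1 hx
    refine Finset.mem_coe.2 (Finset.mem_Ico.2 ⟨hmin x hx', ?_⟩)
    by_contra! hle
    obtain ⟨hm1, rfl⟩ := Finset.mem_filter.1 hm
    obtain ⟨hx1, hxa⟩ := Finset.mem_filter.1 hx'
    refine (Finset.mem_filter.1 hm1).2.2 (H.net_antitone hle ?_)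
    rw [← hxa]
    exact (Finset.mem_filter.1 hx1).2.1
  · intro x hx y hy hxy
    exact Prod.ext hxy ((Finset.mem_filter.1 hx).2.trans (Finset.mem_filter.1 hy).2.symm)

open Classical in
/-- The pairs of distinct net points of the same level whose distance is comparable with the scale
of this level. -/
noncomputable def close : Finset ((ℕ × Plane) × Plane) :=
  ((Finset.range H.height ×ˢ P) ×ˢ P).filter fun x => x.1.2 ∈ H.net x.1.1 ∧ x.2 ∈ H.net x.1.1 ∧
    x.1.2 ≠ x.2 ∧ dist x.1.2 x.2 ≤ 44 * (2 ^ x.1.1 * H.δ)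

theorem mem_close {i : ℕ} {a b : Plane} : ((i, a), b) ∈ H.close ↔
    a ∈ H.net i ∧ b ∈ H.net i ∧ a ≠ b ∧ dist a b ≤ 44 * (2 ^ i * H.δ) := by
  simp only [close, Finset.mem_filter, Finset.mem_product, Finset.mem_range]
  exact ⟨fun h => h.2, fun h => ⟨⟨⟨H.lt_height h.1 h.2.1 h.2.2.1, H.net_subset i h.1⟩,
    H.net_subset i h.2.1⟩, h⟩⟩

theorem mem_close_swap {i : ℕ} {a b : Plane} (h : ((i, a), b) ∈ H.close) :
    ((i, b), a) ∈ H.close := by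
  rw [mem_close] at *
  exact ⟨h.2.1, h.1, h.2.2.1.symm, by rw [dist_comm]; exact h.2.2.2⟩

/-- Packing bound: boundedly many points at mutual distance at least `r` lie within `44 * r` of a
given point. -/
theorem exists_packing_bound : ∃ M : ℕ, ∀ (S : Finset Plane) (c : Plane) (r : ℝ), 0 < r →
    (∀ a ∈ S, ∀ b ∈ S, a ≠ b → r ≤ dist a b) → (∀ a ∈ S, dist c a ≤ 44 * r) → S.card ≤ M := by
  classical
  -- After rescaling by `r⁻¹` the points are at mutual distance at least 1, so each ball of radius
  -- `1 / 2` holds at most one.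
  obtain ⟨t, -, ht, hcov⟩ := (isCompact_closedBall (0 : Plane) 44).finite_cover_balls
    (e := 1 / 2) (by norm_num)
  refine ⟨ht.toFinset.card, fun S c r hr hsep hS => ?_⟩
  have key : ∀ a ∈ S, ∃ x ∈ t, dist (r⁻¹ • (a - c)) x < 1 / 2 := fun a ha => by
    have : r⁻¹ • (a - c) ∈ Metric.closedBall (0 : Plane) 44 := by
      rw [mem_closedBall_zero_iff, norm_smul, Real.norm_of_nonneg (by positivity),
        ← dist_eq_norm, dist_comm, inv_mul_le_iff₀ hr, mul_comm]
      exact hS a ha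
    simpa using hcov this
  choose! f hf using key
  refine Finset.card_le_card_of_injOn f (fun a ha => by simpa using (hf a ha).1) ?_
  intro a ha b hb hab
  by_contra hne
  have h1 := (hf a ha).2
  have h2 := (hf b hb).2
  rw [← hab, dist_comm] at h2
  have h3 := dist_triangle (r⁻¹ • (a - c)) (f a) (r⁻¹ • (b - c))
  have h4 : dist (r⁻¹ • (a - c)) (r⁻¹ • (b - c)) = r⁻¹ * dist a b := by
    rw [dist_smul₀, dist_sub_right, Real.norm_of_nonneg (by positivity)]
  have h5 : 1 ≤ r⁻¹ * dist a b := by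
    rw [le_inv_mul_iff₀ hr, mul_one]; exact hsep a ha b hb hne
  linarith

theorem exists_card_close_le : ∃ M : ℕ, ∀ (P : Finset Plane) (H : NetHierarchy P),
    H.close.card ≤ M * P.card := by
  classical
  obtain ⟨M, hM⟩ := exists_packing_bound
  refine ⟨2 * (M * 6), fun P H => ?_⟩
  -- Since `2 ^ 6 > 44`, two close points cannot both survive six more levels; up to swapping, the
  -- first one is dropped.
  set X := H.close.filter fun x => x.1.2 ∉ H.net (x.1.1 + 6)
  have hX : X.card ≤ M * (6 * P.card) := by
    refine (Finset.card_le_mul_card_image_of_maps_to (f := Prod.fst) (t := H.dropped 6)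
      (fun x hx => ?_) M fun y _ => ?_).trans (Nat.mul_le_mul_left _ (H.card_dropped_le 6))
    · obtain ⟨h1, h2⟩ := Finset.mem_filter.1 hx
      obtain ⟨h3, h4⟩ := Finset.mem_filter.1 h1
      exact Finset.mem_filter.2 ⟨(Finset.mem_product.1 h3).1, h4.1, h2⟩
    · rw [← Finset.card_image_of_injOn (f := Prod.snd)]
      · have hmem : ∀ b ∈ (X.filter fun x => x.1 = y).image Prod.snd, (y, b) ∈ H.close := by
          intro b hb
          obtain ⟨x, hx, rfl⟩ := Finset.mem_image.1 hb
          obtain ⟨hxX, rfl⟩ := Finset.mem_filter.1 hx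
          exact (Finset.mem_filter.1 hxX).1
        refine hM _ y.2 _ (H.scale_pos y.1) (fun a ha b hb => ?_) fun a ha => ?_
        · exact H.separated y.1 a (H.mem_close.1 (hmem a ha)).2.1 b
            (H.mem_close.1 (hmem b hb)).2.1
        · exact (H.mem_close.1 (hmem a ha)).2.2.2
      · intro x hx z hz hxz
        exact Prod.ext ((Finset.mem_filter.1 hx).2.trans (Finset.mem_filter.1 hz).2.symm) hxz
  have hsub : H.close ⊆ X ∪ X.image fun x => ((x.1.1, x.2), x.1.2) := by
    rintro ⟨⟨i, a⟩, b⟩ h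
    have h' := H.mem_close.1 h
    by_cases ha : a ∈ H.net (i + 6)
    · by_cases hb : b ∈ H.net (i + 6)
      · have := H.separated _ a ha b hb h'.2.2.1
        rw [pow_add] at this
        linarith [h'.2.2.2, H.scale_pos i]
      · exact Finset.mem_union_right _ (Finset.mem_image.2
          ⟨((i, b), a), Finset.mem_filter.2 ⟨H.mem_close_swap h, hb⟩, rfl⟩)
    · exact Finset.mem_union_left _ (Finset.mem_filter.2 ⟨h, ha⟩)
  have h1 := (Finset.card_le_card hsub).trans (Finset.card_union_le _ _)
  have h2 : (X.image fun x => ((x.1.1, x.2), x.1.2)).card ≤ X.card := Finset.card_image_le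
  calc H.close.card ≤ 2 * (M * (6 * P.card)) := by omega
    _ = 2 * (M * 6) * P.card := by ring

end NetHierarchy

namespace ConeStep

variable {E F : Finset (Plane × Plane)} {u x y : Plane}

theorem mono (h : E ⊆ F) (hxy : ConeStep E u x y) : ConeStep F u x y :=
  ⟨hxy.1.imp (@h _) (@h _), hxy.2⟩

theorem swap (h : ConeStep E (-u) x y) : ConeStep E u y x :=
  ⟨h.1.symm, by simpa using InCone.neg_left.1 h.2⟩

end ConeStep

/-! ### Collecting trees and cross edges -/

namespace NetHierarchy

variable {P : Finset Plane} (H : NetHierarchy P) {u : Plane}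

/-- The Steiner point above the net point `a` of level `i` in direction `u`. -/
noncomputable def gate (u : Plane) (i : ℕ) (a : Plane) : Plane := a + (4 * (2 ^ i - 1) * H.δ) • u

@[simp]
theorem gate_zero (u a : Plane) : H.gate u 0 a = a := by simp [gate]

open Classical in
/-- The pairs of a level and a net point that are joined to other net points. -/
noncomputable def marks : Finset (ℕ × Plane) :=
  P.image (Prod.mk 0) ∪ (H.dropped 1 ∪ (H.dropped 1).image (fun x => (x.1 + 1, H.par x.1 x.2))) ∪
    H.close.image Prod.fst

theorem card_marks_le : H.marks.card ≤ 3 * P.card + H.close.card := by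
  classical
  have h1 := Finset.card_union_le (P.image (Prod.mk 0) ∪
    (H.dropped 1 ∪ (H.dropped 1).image (fun x => (x.1 + 1, H.par x.1 x.2)))) (H.close.image Prod.fst)
  have h2 := Finset.card_union_le (P.image (Prod.mk 0))
    (H.dropped 1 ∪ (H.dropped 1).image (fun x => (x.1 + 1, H.par x.1 x.2)))
  have h3 := Finset.card_union_le (H.dropped 1)
    ((H.dropped 1).image (fun x => (x.1 + 1, H.par x.1 x.2)))
  have h4 : (P.image (Prod.mk 0)).card ≤ P.card := Finset.card_image_le
  have h5 : ((H.dropped 1).image (fun x => (x.1 + 1, H.par x.1 x.2))).card ≤ _ :=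
    Finset.card_image_le
  have h6 : (H.close.image Prod.fst).card ≤ _ := Finset.card_image_le
  have h7 := H.card_dropped_le 1
  have e : H.marks.card = (P.image (Prod.mk 0) ∪ (H.dropped 1 ∪ (H.dropped 1).image
    (fun x => (x.1 + 1, H.par x.1 x.2))) ∪ H.close.image Prod.fst).card := by
    unfold marks; congr!
  omega

open Classical in
/-- The next marked level of `a` above the level `i`. -/
noncomputable def nextMark (i : ℕ) (a : Plane) : ℕ :=
  -- The default `i` yields a degenerate pair, which contributes no edge.
  if h : ∃ j, i < j ∧ (j, a) ∈ H.marks then Nat.find h else i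

theorem nextMark_spec {i j : ℕ} {a : Plane} (hij : i < j) (hj : (j, a) ∈ H.marks) :
    i < H.nextMark i a ∧ H.nextMark i a ≤ j ∧ (H.nextMark i a, a) ∈ H.marks := by
  classical
  have h : ∃ j, i < j ∧ (j, a) ∈ H.marks := ⟨j, hij, hj⟩
  rw [nextMark, dif_pos h]
  exact ⟨(Nat.find_spec h).1, Nat.find_min' h ⟨hij, hj⟩, (Nat.find_spec h).2⟩

open Classical in
/-- The edges of the tree that collects the points of `P` in direction `u`. -/
noncomputable def treeEdges (u : Plane) : Finset (Plane × Plane) :=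
  H.marks.image (fun x => (H.gate u x.1 x.2, H.gate u (H.nextMark x.1 x.2) x.2)) ∪
    (H.dropped 1).image fun x => (H.gate u x.1 x.2, H.gate u (x.1 + 1) (H.par x.1 x.2))

open Classical in
/-- The edges joining the tree of direction `u` with that of direction `-u`. -/
noncomputable def crossEdges (u : Plane) : Finset (Plane × Plane) :=
  H.close.image fun x => (H.gate u x.1.1 x.1.2, H.gate (-u) x.1.1 x.2)

open Classical in
/-- The edges of the network, for a finite set `D` of directions. -/
noncomputable def edges (D : Finset Plane) : Finset (Plane × Plane) :=
  D.biUnion fun u => (H.treeEdges u ∪ H.treeEdges (-u)) ∪ H.crossEdges u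

theorem card_treeEdges_le (u : Plane) : (H.treeEdges u).card ≤ 4 * P.card + H.close.card := by
  classical
  have h1 : (H.treeEdges u).card ≤ _ := Finset.card_union_le _ _
  have h2 : (H.marks.image (fun x => (H.gate u x.1 x.2, H.gate u (H.nextMark x.1 x.2) x.2))).card
    ≤ _ := Finset.card_image_le
  have h3 : ((H.dropped 1).image fun x =>
    (H.gate u x.1 x.2, H.gate u (x.1 + 1) (H.par x.1 x.2))).card ≤ _ := Finset.card_image_le
  have h4 := H.card_dropped_le 1
  have h5 := H.card_marks_le
  refine h1.trans ((add_le_add (h2.trans h5) (h3.trans h4)).trans ?_)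
  omega

theorem card_edges_le (D : Finset Plane) :
    (H.edges D).card ≤ D.card * (8 * P.card + 3 * H.close.card) := by
  classical
  refine Finset.card_biUnion_le_card_mul _ _ _ fun u _ => ?_
  have h1 := Finset.card_union_le (H.treeEdges u ∪ H.treeEdges (-u)) (H.crossEdges u)
  have h2 := Finset.card_union_le (H.treeEdges u) (H.treeEdges (-u))
  have h3 : (H.crossEdges u).card ≤ H.close.card := Finset.card_image_le
  have h4 := H.card_treeEdges_le u
  have h5 := H.card_treeEdges_le (-u)
  refine h1.trans ((add_le_add (h2.trans (add_le_add h4 h5)) h3).trans ?_)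
  omega

theorem reflTransGen_gate_of_le (hu : ‖u‖ = 1) {a : Plane} {j : ℕ} (hj : (j, a) ∈ H.marks) :
    ∀ n i : ℕ, j - i = n → i ≤ j → (i, a) ∈ H.marks →
      Relation.ReflTransGen (ConeStep (H.treeEdges u) u) (H.gate u i a) (H.gate u j a) := by
  classical
  intro n
  induction n using Nat.strong_induction_on with
  | _ n ih =>
    intro i hn hij hi
    rcases hij.eq_or_lt with rfl | hlt
    · exact .refl
    obtain ⟨h1, h2, h3⟩ := H.nextMark_spec hlt hj
    refine .head ⟨.inl (Finset.mem_union_left _ (Finset.mem_image.2 ⟨(i, a), hi, rfl⟩)), ?_⟩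
      (ih _ (by dsimp only; omega) _ rfl h2 h3)
    have e : H.gate u (H.nextMark i a) a - H.gate u i a
        = (4 * (2 ^ H.nextMark i a - 2 ^ i) * H.δ) • u := by
      unfold gate; module
    rw [e]
    have h4 : (2 : ℝ) ^ i ≤ 2 ^ H.nextMark i a := pow_le_pow_right₀ one_le_two h1.le
    have h5 := H.δ_pos
    exact InCone.smul_self hu (mul_nonneg (by linarith) h5.le)

theorem zero_mem_marks {p : Plane} (hp : p ∈ P) : (0, p) ∈ H.marks :=
  Finset.mem_union_left _ (Finset.mem_union_left _ (Finset.mem_image_of_mem _ hp))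

theorem mem_marks_of_mem_dropped {x : ℕ × Plane} (hx : x ∈ H.dropped 1) : x ∈ H.marks :=
  Finset.mem_union_left _ (Finset.mem_union_right _ (Finset.mem_union_left _ hx))

theorem par_mem_marks {x : ℕ × Plane} (hx : x ∈ H.dropped 1) :
    (x.1 + 1, H.par x.1 x.2) ∈ H.marks :=
  Finset.mem_union_left _ (Finset.mem_union_right _ (Finset.mem_union_right _
    (Finset.mem_image.2 ⟨x, hx, rfl⟩)))

theorem mem_marks_of_mem_close {x : (ℕ × Plane) × Plane} (hx : x ∈ H.close) : x.1 ∈ H.marks :=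
  Finset.mem_union_right _ (Finset.mem_image_of_mem _ hx)

/-- The gate rises by `4 * 2 ^ i * δ` while the parent is at most `2 ^ (i + 1) * δ` away, exactly
half; this fixes the factor 4 in `gate`. -/
theorem coneStep_par (hu : ‖u‖ = 1) {x : ℕ × Plane} (hx : x ∈ H.dropped 1) :
    ConeStep (H.treeEdges u) u (H.gate u x.1 x.2) (H.gate u (x.1 + 1) (H.par x.1 x.2)) := by
  classical
  refine ⟨.inl (Finset.mem_union_right _ (Finset.mem_image.2 ⟨x, hx, rfl⟩)),
    InCone.of_norm_sub_le hu (t := 4 * (2 ^ x.1 * H.δ)) ?_⟩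
  have e : H.gate u (x.1 + 1) (H.par x.1 x.2) - H.gate u x.1 x.2 - (4 * (2 ^ x.1 * H.δ)) • u
      = H.par x.1 x.2 - x.2 := by
    unfold gate; rw [pow_succ]; module
  rw [e, ← dist_eq_norm, dist_comm]
  have := H.dist_par x.1 x.2 (Finset.mem_filter.1 hx).2.1
  rw [pow_succ] at this
  linarith

theorem exists_reflTransGen_gate_anc (hu : ‖u‖ = 1) {p : Plane} (hp : p ∈ P) (i : ℕ)
    (hi : i ≤ H.height) : ∃ j ≤ i, (j, H.anc p i) ∈ H.marks ∧
      Relation.ReflTransGen (ConeStep (H.treeEdges u) u) p (H.gate u j (H.anc p i)) := by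
  induction i with
  | zero => exact ⟨0, le_rfl, H.zero_mem_marks hp, by simpa [anc] using .refl⟩
  | succ i ih =>
    obtain ⟨j, hj, hm, hpath⟩ := ih (by omega)
    by_cases ha : H.anc p i ∈ H.net (i + 1)
    -- A surviving ancestor needs no step: the walk waits at its last marked gate, hence only `j ≤
    -- i`.
    · rw [anc, H.par_eq _ _ ha]
      exact ⟨j, by omega, hm, hpath⟩
    · have hd : (i, H.anc p i) ∈ H.dropped 1 := Finset.mem_filter.2
        ⟨Finset.mem_product.2 ⟨Finset.mem_range.2 (by omega),
          H.net_subset i (H.anc_mem hp i)⟩, H.anc_mem hp i, ha⟩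
      exact ⟨i + 1, le_rfl, H.par_mem_marks hd, (hpath.trans (H.reflTransGen_gate_of_le hu
        (H.mem_marks_of_mem_dropped hd) _ j rfl hj hm)).tail (H.coneStep_par hu hd)⟩

theorem reflTransGen_gate_anc (hu : ‖u‖ = 1) {p b : Plane} (hp : p ∈ P) {i : ℕ}
    (h : ((i, H.anc p i), b) ∈ H.close) :
    Relation.ReflTransGen (ConeStep (H.treeEdges u) u) p (H.gate u i (H.anc p i)) := by
  have h' := H.mem_close.1 h
  obtain ⟨j, hj, hm, hpath⟩ := H.exists_reflTransGen_gate_anc hu hp i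
    (H.lt_height h'.1 h'.2.1 h'.2.2.1).le
  exact hpath.trans (H.reflTransGen_gate_of_le hu (H.mem_marks_of_mem_close h) _ j rfl hj hm)

/-- The representatives of `p` and `q` at a suitable level are close and well separated. -/
theorem exists_level {p q : Plane} (hp : p ∈ P) (hq : q ∈ P) (hpq : p ≠ q) :
    ∃ i, ((i, H.anc p i), H.anc q i) ∈ H.close ∧
      16 * (2 ^ i - 1) * H.δ ≤ dist (H.anc p i) (H.anc q i) := by
  classical
  have hδ := H.δ_pos
  have hd : 0 < dist p q := dist_pos.2 hpq
  -- Take the level just before the first such `i`. The two ancestors together move by at most `4 *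
  -- (2 ^ i - 1) * δ`, so 20 leaves the lower factor `16 = 20 - 4` and the upper factor `44 = 2 * 20
  -- + 4`.
  have hex : ∃ i : ℕ, dist p q < 20 * (2 ^ i - 1) * H.δ := by
    obtain ⟨i, hi⟩ := pow_unbounded_of_one_lt (dist p q / (20 * H.δ) + 1) one_lt_two
    refine ⟨i, ?_⟩
    rw [← lt_sub_iff_add_lt, div_lt_iff₀ (by positivity)] at hi
    linarith
  obtain ⟨i, hi⟩ : ∃ i, Nat.find hex = i + 1 := Nat.exists_eq_succ_of_ne_zero fun h => by
    have := Nat.find_spec hex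
    rw [h] at this
    simp at this
    linarith
  have h1 := Nat.find_spec hex
  have h2 := not_lt.1 (Nat.find_min hex (m := i) (by omega))
  rw [hi, pow_succ] at h1
  have h3 := H.dist_anc_le hp i
  have h4 := H.dist_anc_le hq i
  have h5 := dist_triangle4 p (H.anc p i) (H.anc q i) q
  have h6 := dist_triangle4 (H.anc p i) p q (H.anc q i)
  rw [dist_comm (H.anc q i) q] at h5
  rw [dist_comm (H.anc p i) p] at h6
  have h7 : 0 ≤ (2 ^ i - 1) * H.δ :=
    mul_nonneg (sub_nonneg.2 (one_le_pow₀ one_le_two)) hδ.le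
  refine ⟨i, H.mem_close.2 ⟨H.anc_mem hp i, H.anc_mem hq i, dist_pos.1 ?_, ?_⟩, ?_⟩ <;> linarith

theorem coneStep_cross (hu : ‖u‖ = 1) {i : ℕ} {a b : Plane} (h : ((i, a), b) ∈ H.close)
    (hsep : 16 * (2 ^ i - 1) * H.δ ≤ dist a b) (hdir : ‖(b - a) - dist a b • u‖ ≤ dist a b / 4) :
    ConeStep (H.crossEdges u) u (H.gate u i a) (H.gate (-u) i b) := by
  classical
  refine ⟨.inl (Finset.mem_image.2 ⟨_, h, rfl⟩),
    -- The two gates use up `8 * (2 ^ i - 1) * δ` of the distance, at most half of it by `hsep`; so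
    -- `t / 2` is still at least `dist a b / 4`.
    InCone.of_norm_sub_le hu (t := dist a b - 8 * (2 ^ i - 1) * H.δ) ?_⟩
  have e : H.gate (-u) i b - H.gate u i a - (dist a b - 8 * (2 ^ i - 1) * H.δ) • u
      = (b - a) - dist a b • u := by
    unfold gate; module
  rw [e]
  linarith

theorem exists_reflTransGen_edges {D : Finset Plane} (hD : ∀ u ∈ D, ‖u‖ = 1)
    (hdense : ∀ v : Plane, ‖v‖ = 1 → ∃ u ∈ D, ‖v - u‖ ≤ 1 / 4) {p q : Plane}
    (hp : p ∈ P) (hq : q ∈ P) (hpq : p ≠ q) :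
    ∃ u, ‖u‖ = 1 ∧ Relation.ReflTransGen (ConeStep (H.edges D) u) p q := by
  classical
  obtain ⟨i, hcl, hsep⟩ := H.exists_level hp hq hpq
  set a := H.anc p i
  set b := H.anc q i
  have hab : 0 < dist a b := dist_pos.2 (H.mem_close.1 hcl).2.2.1
  obtain ⟨u, huD, hu⟩ := hdense ((dist a b)⁻¹ • (b - a)) (by
    rw [norm_smul, Real.norm_of_nonneg (by positivity), ← dist_eq_norm, dist_comm b a,
      inv_mul_cancel₀ hab.ne'])
  have hu1 := hD u huD
  have hdir : ‖(b - a) - dist a b • u‖ ≤ dist a b / 4 := by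
    have e : (b - a) - dist a b • u = dist a b • ((dist a b)⁻¹ • (b - a) - u) := by
      rw [smul_sub, smul_inv_smul₀ hab.ne']
    rw [e, norm_smul, Real.norm_of_nonneg hab.le]
    linarith [mul_le_mul_of_nonneg_left hu hab.le]
  have hsub : (H.treeEdges u ∪ H.treeEdges (-u)) ∪ H.crossEdges u ⊆ H.edges D :=
    Finset.subset_biUnion_of_mem
      (fun u => (H.treeEdges u ∪ H.treeEdges (-u)) ∪ H.crossEdges u) huD
  have h1 : Relation.ReflTransGen (ConeStep (H.edges D) u) p (H.gate u i a) :=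
    Relation.ReflTransGen.mono (fun _ _ h => ConeStep.mono
      ((Finset.subset_union_left.trans Finset.subset_union_left).trans hsub) h)
      _ _ (H.reflTransGen_gate_anc hu1 hp hcl)
  have h2 : ConeStep (H.edges D) u (H.gate u i a) (H.gate (-u) i b) :=
    (H.coneStep_cross hu1 hcl hsep hdir).mono (Finset.subset_union_right.trans hsub)
  have h3 : Relation.ReflTransGen (ConeStep (H.edges D) u) (H.gate (-u) i b) q :=
    Relation.ReflTransGen.mono (fun _ _ h => ConeStep.swap (ConeStep.mono
      ((Finset.subset_union_right.trans Finset.subset_union_left).trans hsub) h))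
      _ _ (H.reflTransGen_gate_anc (u := -u) (by rwa [norm_neg]) hq (H.mem_close_swap hcl)).swap
  exact ⟨u, hu1, (h1.tail h2).trans h3⟩

end NetHierarchy

/-! ### Finitely many directions and the final count -/

theorem exists_finset_directions : ∃ D : Finset Plane, (∀ u ∈ D, ‖u‖ = 1) ∧
    ∀ v : Plane, ‖v‖ = 1 → ∃ u ∈ D, ‖v - u‖ ≤ 1 / 4 := by
  obtain ⟨t, hsub, ht, hcov⟩ := (isCompact_sphere (0 : Plane) 1).finite_cover_balls
    (e := 1 / 4) (by norm_num)
  refine ⟨ht.toFinset, fun u hu => by simpa using hsub (ht.mem_toFinset.1 hu), fun v hv => ?_⟩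
  obtain ⟨u, hu, h⟩ := Set.mem_iUnion₂.1 (hcov (mem_sphere_zero_iff_norm.2 hv))
  exact ⟨u, ht.mem_toFinset.2 hu, by rw [← dist_eq_norm]; exact h.le⟩

theorem mainTheorem1 :
    ∃ C : ℕ, ∀ P : Finset Plane, ∃ N : StraightLineGraph,
      N.IsIncreasingChordSteinerNetwork P ∧
      N.IsSelfApproachingSteinerNetwork P ∧
      N.numVerts ≤ C * P.card ∧
      N.numEdges ≤ C * P.card := by
  classical
  obtain ⟨D, hD, hdense⟩ := exists_finset_directions
  obtain ⟨M, hM⟩ := NetHierarchy.exists_card_close_le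
  refine ⟨1 + 2 * (D.card * (8 + 3 * M)), fun P => ?_⟩
  obtain ⟨H⟩ := NetHierarchy.nonempty P
  have hP : P ⊆ (StraightLineGraph.ofPairs P (H.edges D)).verts := Finset.subset_union_left
  have hpath (p q : Plane) (hp : p ∈ P) (hq : q ∈ P) :
      ∃ w : (StraightLineGraph.ofPairs P (H.edges D)).graph.Walk ⟨p, hP hp⟩ ⟨q, hP hq⟩,
        w.IsPath ∧ HasIncreasingChords (StraightLineGraph.walkCurve w) := by
    by_cases hpq : p = q
    · subst hpq
      exact ⟨.nil, .nil, fun a b c d _ _ _ => by simp [StraightLineGraph.walkCurve]⟩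
    · obtain ⟨u, hu, h⟩ := H.exists_reflTransGen_edges hD hdense hp hq hpq
      exact StraightLineGraph.exists_path_hasIncreasingChords hu h _ _
  have hE : (H.edges D).card ≤ D.card * (8 + 3 * M) * P.card :=
    calc (H.edges D).card ≤ D.card * (8 * P.card + 3 * H.close.card) := H.card_edges_le D
      _ ≤ D.card * (8 * P.card + 3 * (M * P.card)) := by gcongr; exact hM P H
      _ = D.card * (8 + 3 * M) * P.card := by ring
  refine ⟨StraightLineGraph.ofPairs P (H.edges D), ⟨hP, hpath⟩, ⟨hP, fun p q hp hq => ?_⟩,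
    StraightLineGraph.numVerts_ofPairs_le.trans ?_,
    StraightLineGraph.numEdges_ofPairs_le.trans ?_⟩
  · obtain ⟨w, hw, hw'⟩ := hpath p q hp hq
    exact ⟨w, hw, hw'.isSelfApproaching⟩
  · nlinarith
  · nlinarith [Nat.zero_le P.card]
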